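/- For $e\in\mathbb{N}$ let $\varphi_e$ be the $e$-th partial computable function in a standard Gödel numbering, let $W_e$ be the domain of $\varphi_e$, and let $\emptyset'=\{e \mid \varphi_e(e)\text{ is defined}\}$ be the halting set. For $A\subseteq\mathbb{N}$ let $A'=\{e \mid \{e\}^A(e)\text{ is defined}\}$ be its Turing jump, where $\{e\}^A$ is the $e$-th partial function computable with oracle $A$; the set $A$ is called low if $A'\equiv_T\emptyset'$. **Theorem.** There exist a low computably enumerable set $A\subseteq\mathbb{N}$ and an $A$-computable function $h:\mathbb{N}\times\mathbb{N}\to\mathbb{N}$ such that for every (total) computable function $f:\mathbb{N}\to\mathbb{N}$ there exists $n$ with $$W_{f(n)}\neq W_{h(n,f(n))}.$$ Moreover, $A$ and $h$ can be chosen so that $h$ uses only two bits of $A$ per argument: there are computable functions $q_0,q_1:\mathbb{N}^2\to\mathbb{N}$ and a computable function $g$ such that, for all $n,x$, $h(n,x)=g\bigl(n,x,A(q_0(n,x)),A(q_1(n,x))\bigr)$, where $A(\cdot)$ denotes the characteristic function of $A$. -/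

import Mathlib

/-- The `e`-th computably enumerable set: `W e` is the domain of the `e`-th partial computable
function, in Mathlib's numbering of the codes of partial computable functions. -/
def W (e : ℕ) : Set ℕ :=
  {x | (Nat.Partrec.Code.eval (Denumerable.ofNat Nat.Partrec.Code e) x).Dom}

/-- The halting set `∅' = {e | φ_e(e)↓}`. -/
def haltingSet : Set ℕ := {e | e ∈ W e}

open Classical in
/-- The characteristic function of a set of natural numbers. -/
noncomputable def charFun (A : Set ℕ) (n : ℕ) : ℕ := if n ∈ A then 1 else 0

/-- Programs with an oracle: the constructors of `Nat.Partrec.Code` together with one instruction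
that queries the oracle. -/
inductive OracleCode : Type
  | zero : OracleCode
  | succ : OracleCode
  | left : OracleCode
  | right : OracleCode
  | oracle : OracleCode
  | pair : OracleCode → OracleCode → OracleCode
  | comp : OracleCode → OracleCode → OracleCode
  | prec : OracleCode → OracleCode → OracleCode
  | rfind' : OracleCode → OracleCode

namespace OracleCode

/-- The partial function computed by a program with oracle `g`; apart from the clause for the
oracle this is `Nat.Partrec.Code.eval`. -/
def eval (g : ℕ → ℕ) : OracleCode → ℕ →. ℕ
  | zero => pure 0
  | succ => Nat.succ
  | left => ↑fun n : ℕ => n.unpair.1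
  | right => ↑fun n : ℕ => n.unpair.2
  | oracle => g
  | pair cf cg => fun n => Nat.pair <$> eval g cf n <*> eval g cg n
  | comp cf cg => fun n => eval g cg n >>= eval g cf
  | prec cf cg =>
    Nat.unpaired fun a n =>
      n.rec (eval g cf a) fun y IH => do
        let i ← IH
        eval g cg (Nat.pair a (Nat.pair y i))
  | rfind' cf =>
    Nat.unpaired fun a m =>
      (Nat.rfind fun n => (fun m => m = 0) <$> eval g cf (Nat.pair a (n + m))).map (· + m)

/-- The Gödel number of a program with oracle. -/
def encodeCode : OracleCode → ℕ
  | zero => 0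
  | succ => 1
  | left => 2
  | right => 3
  | oracle => 4
  | pair cf cg => 2 * (2 * Nat.pair (encodeCode cf) (encodeCode cg)) + 5
  | comp cf cg => 2 * (2 * Nat.pair (encodeCode cf) (encodeCode cg) + 1) + 5
  | prec cf cg => (2 * (2 * Nat.pair (encodeCode cf) (encodeCode cg)) + 1) + 5
  | rfind' cf => (2 * (2 * encodeCode cf + 1) + 1) + 5

/-- The program with a given Gödel number. -/
def ofNatCode : ℕ → OracleCode
  | 0 => zero
  | 1 => succ
  | 2 => left
  | 3 => right
  | 4 => oracle
  | n + 5 =>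
    let m := n.div2.div2
    have hm : m < n + 5 := by
      simp only [m, Nat.div2_val]
      exact
        lt_of_le_of_lt (le_trans (Nat.div_le_self _ _) (Nat.div_le_self _ _))
          (Nat.lt_add_of_pos_right (by decide))
    have _m1 : m.unpair.1 < n + 5 := lt_of_le_of_lt m.unpair_left_le hm
    have _m2 : m.unpair.2 < n + 5 := lt_of_le_of_lt m.unpair_right_le hm
    match n.bodd, n.div2.bodd with
    | false, false => pair (ofNatCode m.unpair.1) (ofNatCode m.unpair.2)
    | false, true => comp (ofNatCode m.unpair.1) (ofNatCode m.unpair.2)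
    | true, false => prec (ofNatCode m.unpair.1) (ofNatCode m.unpair.2)
    | true, true => rfind' (ofNatCode m)
  decreasing_by all_goals first | exact _m1 | exact _m2 | exact hm

theorem encode_ofNatCode : ∀ n, encodeCode (ofNatCode n) = n
  | 0 => by simp [ofNatCode, encodeCode]
  | 1 => by simp [ofNatCode, encodeCode]
  | 2 => by simp [ofNatCode, encodeCode]
  | 3 => by simp [ofNatCode, encodeCode]
  | 4 => by simp [ofNatCode, encodeCode]
  | n + 5 => by
    let m := n.div2.div2
    have hm : m < n + 5 := by
      simp only [m, Nat.div2_val]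
      exact
        lt_of_le_of_lt (le_trans (Nat.div_le_self _ _) (Nat.div_le_self _ _))
          (Nat.lt_add_of_pos_right (by decide))
    have _m1 : m.unpair.1 < n + 5 := lt_of_le_of_lt m.unpair_left_le hm
    have _m2 : m.unpair.2 < n + 5 := lt_of_le_of_lt m.unpair_right_le hm
    have IH := encode_ofNatCode m
    have IH1 := encode_ofNatCode m.unpair.1
    have IH2 := encode_ofNatCode m.unpair.2
    conv_rhs => rw [← Nat.bit_bodd_div2 n, ← Nat.bit_bodd_div2 n.div2]
    simp only [ofNatCode.eq_6]
    cases n.bodd <;> cases n.div2.bodd <;>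
      simp [m, encodeCode, IH, IH1, IH2, Nat.bit_val]
  decreasing_by all_goals first | exact _m1 | exact _m2 | exact hm

/-- The Gödel numbering of programs with oracle is a bijection with `ℕ`. -/
instance instDenumerable : Denumerable OracleCode :=
  Denumerable.mk'
    ⟨encodeCode, ofNatCode, fun c => by
        induction c <;> simp [encodeCode, ofNatCode, Nat.div2_val, *],
      encode_ofNatCode⟩

end OracleCode

/-- The Turing jump `A' = {e | {e}^A(e)↓}`. -/
def jump (A : Set ℕ) : Set ℕ :=
  {e | (OracleCode.eval (charFun A) (Denumerable.ofNat OracleCode e) e).Dom}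

/-- `A` is low if its jump has the Turing degree of the halting set: `A' ≡_T ∅'`. -/
def IsLow (A : Set ℕ) : Prop :=
  TuringEquivalent (charFun (jump A) : ℕ →. ℕ) (charFun haltingSet : ℕ →. ℕ)

/-- The value `h n x` is computed from `n`, `x` and two bits of `A`, at positions which are
themselves computed from `n` and `x` alone. -/
def ComputableFromTwoBits (A : Set ℕ) (h : ℕ → ℕ → ℕ) : Prop :=
  ∃ (q₀ q₁ : ℕ → ℕ → ℕ) (g : ℕ × ℕ → ℕ × ℕ → ℕ),
    Computable₂ q₀ ∧ Computable₂ q₁ ∧ Computable₂ g ∧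
      ∀ n x, h n x = g (n, x) (charFun A (q₀ n x), charFun A (q₁ n x))

/-!
The function `h n x` is an index of `∅` if `⟨n, x⟩ ∈ A`, and an index of `ℕ` otherwise; it reads a
single bit of `A`. If `W (f n) = W (h n (f n))` for all `n`, then `⟨n, f n⟩ ∈ A ↔ 0 ∉ W (f n)` for
all `n`. It therefore suffices to find a low computably enumerable set `A` contained in
`B = {⟨n, x⟩ | 0 ∈ W x}` which meets every computably enumerable set that has an infinite
intersection with `B` (`exists_isLow_subset`). Indeed, by `A ⊆ B` no pair `⟨n, f n⟩` can then be in
`A`, so `0 ∈ W (f n)` for all `n`, and the graph of `f` is an infinite computably enumerable subset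
of `B` that misses `A`.

Such an `A` is built by the finite-injury construction of a low simple set, carried out inside `B`.
At each stage one pair `(e, x)` is considered, each pair infinitely often; `x` is enumerated if it
has appeared in `W e ∩ B`, if `W e` has not yet met `A`, and if no convergent computation of one of
the first `e + 1` oracle programs on its own index is injured. Each `e` acts at most once
(`LowSubset.eventually_not_acts`), so the `i`-th computation is injured only finitely often, and
either it settles with a bounded use or it diverges at all late stages
(`LowSubset.converges_dichotomy`). Hence the jump of `A` is the limit of a computable sequence, so
the halting set computes it (`turingReducible_haltingSet_of_eventually_eq`); and `e` can use every
large enough element of `W e ∩ B` (`LowSubset.result_inter_nonempty`).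

Computations with an oracle are approximated without a separate step-bounded evaluator: a program
with an oracle is translated to one without, in which the queries are answered from a finite string
(`OracleCode.subst`, `lookupCode`). The translation is primitive recursive in the Gödel number
(`OracleCode.primrec₂_subst`), and it satisfies the use principle
(`OracleCode.eventually_mem_eval_subst`), so that Mathlib's `Nat.Partrec.Code.evaln` applies.
-/

open Filter Encodable Denumerable Nat.Partrec

/-! ### Programs with an oracle -/

namespace OracleCode

/-- The oracle-free program obtained from `o` by replacing each oracle query by a call of the
program `c`. -/
def subst (c : Code) : OracleCode → Code
  | zero => .zero
  | succ => .succ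
  | left => .left
  | right => .right
  | oracle => c
  | pair a b => .pair (subst c a) (subst c b)
  | comp a b => .comp (subst c a) (subst c b)
  | prec a b => .prec (subst c a) (subst c b)
  | rfind' a => .rfind' (subst c a)

theorem mem_rfind_map_eq_zero_iff {f : ℕ → Part ℕ} {n : ℕ} :
    n ∈ Nat.rfind (fun n => (f n).map fun m => decide (m = 0)) ↔
      0 ∈ f n ∧ ∀ m < n, ∃ w ∈ f m, w ≠ 0 := by
  refine Nat.mem_rfind.trans (and_congr ?_ (forall₂_congr fun m _ => ?_))
  · exact (Part.mem_map_iff _).trans (by simp)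
  · exact (Part.mem_map_iff _).trans (by simp)

theorem mem_eval_pair_iff {g : ℕ → ℕ} {a b : OracleCode} {x v : ℕ} : v ∈ eval g (pair a b) x ↔
    ∃ u ∈ eval g a x, ∃ w ∈ eval g b x, Nat.pair u w = v := by
  change v ∈ ((eval g a x).map Nat.pair).bind (fun f => (eval g b x).map f) ↔ _
  simp [Part.mem_bind_iff]

theorem mem_eval_comp_iff {g : ℕ → ℕ} {a b : OracleCode} {x v : ℕ} : v ∈ eval g (comp a b) x ↔
    ∃ u ∈ eval g b x, v ∈ eval g a u :=
  Part.mem_bind_iff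

theorem mem_eval_rfind'_iff {g : ℕ → ℕ} {a : OracleCode} {x v : ℕ} : v ∈ eval g (rfind' a) x ↔
    ∃ n, 0 ∈ eval g a (Nat.pair x.unpair.1 (n + x.unpair.2)) ∧
      (∀ m < n, ∃ w ∈ eval g a (Nat.pair x.unpair.1 (m + x.unpair.2)), w ≠ 0) ∧
      n + x.unpair.2 = v := by
  change v ∈ (Nat.rfind fun n => (eval g a (Nat.pair x.unpair.1 (n + x.unpair.2))).map
    fun m => decide (m = 0)).map (· + x.unpair.2) ↔ _
  refine Part.mem_map_iff _ |>.trans (exists_congr fun n => ?_)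
  exact (and_congr_left' mem_rfind_map_eq_zero_iff).trans and_assoc

theorem mem_code_eval_pair_iff {a b : Code} {x v : ℕ} : v ∈ Code.eval (.pair a b) x ↔
    ∃ u ∈ Code.eval a x, ∃ w ∈ Code.eval b x, Nat.pair u w = v := by
  change v ∈ ((Code.eval a x).map Nat.pair).bind (fun f => (Code.eval b x).map f) ↔ _
  simp [Part.mem_bind_iff]

theorem mem_code_eval_comp_iff {a b : Code} {x v : ℕ} : v ∈ Code.eval (.comp a b) x ↔
    ∃ u ∈ Code.eval b x, v ∈ Code.eval a u :=
  Part.mem_bind_iff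

theorem mem_code_eval_rfind'_iff {a : Code} {x v : ℕ} : v ∈ Code.eval (.rfind' a) x ↔
    ∃ n, 0 ∈ Code.eval a (Nat.pair x.unpair.1 (n + x.unpair.2)) ∧
      (∀ m < n, ∃ w ∈ Code.eval a (Nat.pair x.unpair.1 (m + x.unpair.2)), w ≠ 0) ∧
      n + x.unpair.2 = v := by
  change v ∈ (Nat.rfind fun n => (Code.eval a (Nat.pair x.unpair.1 (n + x.unpair.2))).map
    fun m => decide (m = 0)).map (· + x.unpair.2) ↔ _
  refine Part.mem_map_iff _ |>.trans (exists_congr fun n => ?_)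
  exact (and_congr_left' mem_rfind_map_eq_zero_iff).trans and_assoc

/-- If `c` computes a restriction of `g`, then a computation of `subst c o` is correct for the
oracle `g`. -/
theorem mem_eval_of_mem_eval_subst {c : Code} {g : ℕ → ℕ} (hc : ∀ x v, v ∈ c.eval x → v = g x)
    (o : OracleCode) : ∀ {x v}, v ∈ (subst c o).eval x → v ∈ eval g o x := by
  induction o with
  | zero | succ | left | right => exact id
  | oracle => intro x v h; simpa [eval] using hc x v h
  | pair a b iha ihb =>
    intro x v h
    simp only [subst, mem_eval_pair_iff, mem_code_eval_pair_iff] at h ⊢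
    obtain ⟨u, hu, w, hw, rfl⟩ := h
    exact ⟨u, iha hu, w, ihb hw, rfl⟩
  | comp a b iha ihb =>
    intro x v h
    simp only [subst, mem_eval_comp_iff, mem_code_eval_comp_iff] at h ⊢
    obtain ⟨u, hu, hv⟩ := h
    exact ⟨u, ihb hu, iha hv⟩
  | prec a b iha ihb =>
    intro x v h
    simp only [subst, Code.eval, eval, Nat.unpaired] at h ⊢
    generalize x.unpair.2 = n at h ⊢
    induction n generalizing v with
    | zero => exact iha h
    | succ k ih =>
      obtain ⟨u, hu, hv⟩ := Part.mem_bind_iff.1 h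
      exact Part.mem_bind_iff.2 ⟨u, ih hu, ihb hv⟩
  | rfind' a iha =>
    intro x v h
    simp only [subst, mem_eval_rfind'_iff, mem_code_eval_rfind'_iff] at h ⊢
    obtain ⟨n, hu, hlt, rfl⟩ := h
    refine ⟨n, iha hu, fun m hm => ?_, rfl⟩
    obtain ⟨w, hw, hw'⟩ := hlt m hm
    exact ⟨w, iha hw, hw'⟩

/-- The use principle: an oracle computation makes finitely many queries, so it is carried out
by `subst (c i) o` as soon as `c i` answers these queries. -/
theorem eventually_mem_eval_subst {ι : Type*} {l : Filter ι} {c : ι → Code} {g : ℕ → ℕ}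
    (hc : ∀ x, ∀ᶠ i in l, g x ∈ (c i).eval x) (o : OracleCode) :
    ∀ {x v}, v ∈ eval g o x → ∀ᶠ i in l, v ∈ (subst (c i) o).eval x := by
  induction o with
  | zero | succ | left | right => exact fun h => .of_forall fun _ => h
  | oracle =>
    intro x v h
    obtain rfl : v = g x := by simpa [eval] using h
    exact hc x
  | pair a b iha ihb =>
    intro x v h
    simp only [subst, mem_eval_pair_iff, mem_code_eval_pair_iff] at h ⊢
    obtain ⟨u, hu, w, hw, rfl⟩ := h
    filter_upwards [iha hu, ihb hw] with i hu hw
    exact ⟨u, hu, w, hw, rfl⟩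
  | comp a b iha ihb =>
    intro x v h
    simp only [subst, mem_eval_comp_iff, mem_code_eval_comp_iff] at h ⊢
    obtain ⟨u, hu, hv⟩ := h
    filter_upwards [ihb hu, iha hv] with i hu hv
    exact ⟨u, hu, hv⟩
  | prec a b iha ihb =>
    intro x v h
    simp only [subst, Code.eval, eval, Nat.unpaired] at h ⊢
    generalize x.unpair.2 = n at h ⊢
    induction n generalizing v with
    | zero => exact iha h
    | succ k ih =>
      obtain ⟨u, hu, hv⟩ := Part.mem_bind_iff.1 h
      filter_upwards [ih hu, ihb hv] with i hu hv
      exact Part.mem_bind_iff.2 ⟨u, hu, hv⟩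
  | rfind' a iha =>
    intro x v h
    simp only [subst, mem_eval_rfind'_iff, mem_code_eval_rfind'_iff] at h ⊢
    obtain ⟨n, hu, hlt, rfl⟩ := h
    have hlt' : ∀ᶠ i in l, ∀ m ∈ Set.Iio n, ∃ w,
        w ∈ (subst (c i) a).eval (Nat.pair x.unpair.1 (m + x.unpair.2)) ∧ w ≠ 0 := by
      refine (Filter.eventually_all_finite (Set.finite_Iio n)).2 fun m hm => ?_
      obtain ⟨w, hw, hw'⟩ := hlt m hm
      filter_upwards [iha hw] with i hi
      exact ⟨w, hi, hw'⟩
    filter_upwards [iha hu, hlt'] with i hi hlt'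
    exact ⟨n, hi, hlt', rfl⟩

section
open Primrec

/-- Replacing the oracle queries is primitive recursive in the Gödel number of the program. -/
theorem primrec₂_subst : Primrec₂ fun (c : Code) (n : ℕ) => subst c (ofNat OracleCode n) := by
  -- One step of the recursion, given the list `l` of the values at all smaller Gödel numbers.
  let m : List Code → ℕ := fun l => (l.length - 5).div2.div2
  let g : Code → List Code → Option Code := fun c l =>
    if l.length < 4 then some (ofNat Code l.length) else if l.length = 4 then some c else
      (l[(m l).unpair.1]?).bind fun a => (l[(m l).unpair.2]?).bind fun b => (l[m l]?).map fun r =>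
        bif (l.length - 5).bodd then
          bif (l.length - 5).div2.bodd then Code.rfind' r else Code.prec a b
        else bif (l.length - 5).div2.bodd then Code.comp a b else Code.pair a b
  have hk : Primrec fun l : List Code => l.length - 5 :=
    nat_sub.comp list_length (const 5)
  have hm : Primrec m := nat_div2.comp (nat_div2.comp hk)
  have hg : Primrec₂ g := by
    have hl : Primrec fun p : ((((Code × List Code) × Code) × Code) × Code) => p.1.1.1.2 :=
      snd.comp (fst.comp (fst.comp fst))
    have hr : Primrec fun p : ((((Code × List Code) × Code) × Code) × Code) => p.2 := snd
    have hb : Primrec fun p : ((((Code × List Code) × Code) × Code) × Code) => p.1.2 :=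
      snd.comp fst
    have ha : Primrec fun p : ((((Code × List Code) × Code) × Code) × Code) => p.1.1.2 :=
      snd.comp (fst.comp fst)
    refine Primrec.ite (nat_lt.comp (list_length.comp snd) (const 4))
      (option_some.comp ((Primrec.ofNat Code).comp (list_length.comp snd)))
      (Primrec.ite (Primrec.eq.comp (list_length.comp snd) (const 4)) (option_some.comp fst) ?_)
    refine option_bind (list_getElem?.comp snd (fst.comp (unpair.comp (hm.comp snd)))) ?_
    refine option_bind (list_getElem?.comp (snd.comp fst)
      (snd.comp (unpair.comp (hm.comp (snd.comp fst))))) ?_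
    refine option_map (list_getElem?.comp (snd.comp (fst.comp fst))
      (hm.comp (snd.comp (fst.comp fst)))) ?_
    exact Primrec.cond (nat_bodd.comp (hk.comp hl))
      (Primrec.cond (nat_bodd.comp (nat_div2.comp (hk.comp hl)))
        (Code.primrec_rfind'.comp hr) (Code.primrec₂_prec.comp ha hb))
      (Primrec.cond (nat_bodd.comp (nat_div2.comp (hk.comp hl)))
        (Code.primrec₂_comp.comp ha hb) (Code.primrec₂_pair.comp ha hb))
  refine nat_strong_rec _ hg fun c n => ?_
  have hof : ∀ n, ofNat OracleCode n = ofNatCode n := fun _ => rfl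
  match n with
  -- Below `4` the numberings of `OracleCode` and `Code` agree; `4` is the query instruction.
  | 0 | 1 | 2 | 3 | 4 => simp [g, hof, ofNatCode, subst, Code.ofNatCode_eq, Code.ofNatCode]
  | n + 5 =>
    have hlt : n.div2.div2 < n + 5 := by simp only [Nat.div2_val]; omega
    have h1 := lt_of_le_of_lt n.div2.div2.unpair_left_le hlt
    have h2 := lt_of_le_of_lt n.div2.div2.unpair_right_le hlt
    simp only [g, m, hof, List.length_map, List.length_range, Nat.add_sub_cancel, List.getElem?_map,
      List.getElem?_range, hlt, h1, h2, Option.map_some, Option.bind_some, ofNatCode]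
    rw [if_neg (by omega), if_neg (by omega)]
    cases n.bodd <;> cases n.div2.bodd <;> simp [subst]

end

/-- An oracle-free program, seen as a program with an oracle that it never queries. -/
def ofCode : Code → OracleCode
  | .zero => zero
  | .succ => succ
  | .left => left
  | .right => right
  | .pair a b => pair (ofCode a) (ofCode b)
  | .comp a b => comp (ofCode a) (ofCode b)
  | .prec a b => prec (ofCode a) (ofCode b)
  | .rfind' a => rfind' (ofCode a)

theorem eval_ofCode (g : ℕ → ℕ) (c : Code) : eval g (ofCode c) = c.eval := by
  induction c with
  | zero | succ | left | right => rfl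
  | pair a b iha ihb => simp only [ofCode, eval, Code.eval, iha, ihb]; rfl
  | comp a b iha ihb => simp only [ofCode, eval, Code.eval, iha, ihb]; rfl
  | prec a b iha ihb => simp only [ofCode, eval, Code.eval, iha, ihb]; rfl
  | rfind' a iha => simp only [ofCode, eval, Code.eval, iha]; rfl

/-- The Gödel number of a program that ignores its argument and outputs `n`. -/
def constNum (n : ℕ) : ℕ := encode (ofCode (Code.const n))

theorem primrec_constNum : Primrec constNum := by
  have h : Primrec fun n : ℕ => Nat.rec (motive := fun _ => ℕ) 0
      (fun _ r => 2 * (2 * Nat.pair 1 r + 1) + 5) n := by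
    refine Primrec.nat_rec₁ 0 ?_
    exact (Primrec.nat_add.comp (Primrec.nat_double.comp (Primrec.nat_double_succ.comp
      (Primrec₂.natPair.comp (Primrec.const 1) Primrec.snd))) (Primrec.const 5)).to₂
  refine h.of_eq fun n => ?_
  induction n with
  | zero => rfl
  | succ n ih => simp only [ih]; rfl

end OracleCode

/-! ### Bounded computations -/

theorem Nat.Partrec.Code.eventually_isSome_evaln {c : Code} {x : ℕ} (h : (c.eval x).Dom) :
    ∀ᶠ s in atTop, (c.evaln s x).isSome := by
  obtain ⟨v, hv⟩ := Part.dom_iff_mem.1 h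
  obtain ⟨k, hk⟩ := Code.evaln_complete.1 hv
  filter_upwards [eventually_ge_atTop k] with s hs
  exact Option.isSome_iff_exists.2 ⟨v, Code.evaln_mono hs hk⟩

theorem Nat.Partrec.Code.isSome_evaln_mono {c : Code} {x s t : ℕ} (hst : s ≤ t)
    (h : (c.evaln s x).isSome) : (c.evaln t x).isSome := by
  obtain ⟨v, hv⟩ := Option.isSome_iff_exists.1 h
  exact Option.isSome_iff_exists.2 ⟨v, Code.evaln_mono hst hv⟩

theorem Nat.Partrec.Code.exists_mem_eval_of_isSome_evaln {c : Code} {x s : ℕ}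
    (h : (c.evaln s x).isSome) : ∃ v, v ∈ c.eval x := by
  obtain ⟨v, hv⟩ := Option.isSome_iff_exists.1 h
  exact ⟨v, Code.evaln_sound hv⟩

/-- The `e`-th program halts on `x` within `s` steps, that is, `x` is in the finite stage `s` of the
enumeration of `W e`. -/
def HaltsWithin (s e x : ℕ) : Prop := (Code.evaln s (ofNat Code e) x).isSome

theorem primrecPred_haltsWithin :
    PrimrecPred fun p : ℕ × ℕ × ℕ => HaltsWithin p.1 p.2.1 p.2.2 := by
  have h : Primrec fun p : ℕ × ℕ × ℕ => Code.evaln p.1 (ofNat Code p.2.1) p.2.2 :=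
    Code.primrec_evaln.comp (.pair (.pair .fst ((Primrec.ofNat Code).comp (.comp .fst .snd)))
      (.comp .snd .snd))
  exact Primrec.eq.comp (Primrec.option_isSome.comp h) (Primrec.const true)

/-- A program which, given a string `σ` of oracle answers and a query `x`, returns the entry of `σ`
at `x`, and diverges if `x` is not a position of `σ`. -/
theorem exists_lookupCode :
    ∃ c : Code, ∀ (σ : List ℕ) (x : ℕ), c.eval (Nat.pair (encode σ) x) = (σ[x]? : Part ℕ) := by
  have h : Computable fun n : ℕ => (ofNat (List ℕ) n.unpair.1)[n.unpair.2]? :=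
    (Primrec.list_getElem?.comp ((Primrec.ofNat _).comp (.comp .fst .unpair))
      (.comp .snd .unpair)).to_comp
  obtain ⟨c, hc⟩ := Code.exists_code.1 (Partrec.nat_iff.1 h.ofOption)
  exact ⟨c, fun σ x => by simp [hc]⟩

/-- The program which looks up oracle answers in the string `σ`. -/
noncomputable def lookupCode (σ : List ℕ) : Code := exists_lookupCode.choose.curry (encode σ)

theorem eval_lookupCode (σ : List ℕ) (x : ℕ) : (lookupCode σ).eval x = (σ[x]? : Part ℕ) := by
  rw [lookupCode, Code.eval_curry, exists_lookupCode.choose_spec]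

/-- The characteristic function of `A` on `{0, …, n - 1}`, as a string. -/
noncomputable def initialSegment (A : Set ℕ) (n : ℕ) : List ℕ := (List.range n).map (charFun A)

theorem initialSegment_congr {A B : Set ℕ} {n : ℕ} (h : ∀ k < n, k ∈ A ↔ k ∈ B) :
    initialSegment A n = initialSegment B n :=
  List.map_congr_left fun k hk => by
    have := h k (List.mem_range.1 hk)
    by_cases hA : k ∈ A <;> simp_all [charFun]

theorem mem_eval_lookupCode_initialSegment {A : Set ℕ} {n x v : ℕ} :
    v ∈ (lookupCode (initialSegment A n)).eval x ↔ x < n ∧ v = charFun A x := by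
  rw [eval_lookupCode, Part.mem_ofOption, Option.mem_def, initialSegment, List.getElem?_map]
  by_cases h : x < n <;> simp [h, eq_comm]

theorem primrec₂_initialSegment :
    Primrec₂ fun (L : List ℕ) (n : ℕ) => initialSegment {k | k ∈ L} n := by
  classical
  refine Primrec.list_map (Primrec.list_range.comp .snd) ?_
  have h : PrimrecPred fun p : (List ℕ × ℕ) × ℕ => ∃ a ∈ p.1.1, a = p.2 :=
    (PrimrecRel.exists_mem_list Primrec.eq).comp (.comp .fst .fst) .snd
  refine (Primrec.ite h (.const 1) (.const 0)).of_eq fun p => ?_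
  simp [charFun]

/-- The `i`-th program with an oracle halts on input `i` within `s` steps when its oracle is an
initial segment of `A` of length less than `n`. -/
def Converges (i : ℕ) (A : Set ℕ) (n s : ℕ) : Prop :=
  ∃ m < n, (Code.evaln s (OracleCode.subst (lookupCode (initialSegment A m))
    (ofNat OracleCode i)) i).isSome

theorem Converges.mono {i n s n' s' : ℕ} {A : Set ℕ} (hn : n ≤ n') (hs : s ≤ s')
    (h : Converges i A n s) : Converges i A n' s' := by
  obtain ⟨m, hm, h⟩ := h
  exact ⟨m, hm.trans_le hn, Code.isSome_evaln_mono hs h⟩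

/-- Only the part of the oracle below `n` matters, so that enumerating a number `≥ n` preserves the
computation. -/
theorem Converges.congr {i n s : ℕ} {A B : Set ℕ} (hAB : ∀ k < n, k ∈ A ↔ k ∈ B)
    (h : Converges i A n s) : Converges i B n s := by
  obtain ⟨m, hm, h⟩ := h
  exact ⟨m, hm, by rwa [← initialSegment_congr fun k hk => hAB k (hk.trans hm)]⟩

theorem Converges.mem_jump {i n s : ℕ} {A : Set ℕ} (h : Converges i A n s) : i ∈ jump A := by
  obtain ⟨m, -, h⟩ := h
  obtain ⟨v, hv⟩ := Code.exists_mem_eval_of_isSome_evaln h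
  exact Part.dom_iff_mem.2 ⟨v, OracleCode.mem_eval_of_mem_eval_subst
    (fun x w hw => (mem_eval_lookupCode_initialSegment.1 hw).2) _ hv⟩

theorem exists_converges_of_mem_jump {i : ℕ} {A : Set ℕ} (h : i ∈ jump A) :
    ∃ n s, Converges i A n s := by
  obtain ⟨v, hv⟩ := Part.dom_iff_mem.1 h
  have hc : ∀ x, ∀ᶠ n in atTop, charFun A x ∈ (lookupCode (initialSegment A n)).eval x := by
    intro x
    filter_upwards [eventually_gt_atTop x] with n hn
    exact mem_eval_lookupCode_initialSegment.2 ⟨hn, rfl⟩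
  obtain ⟨m, hm⟩ := (OracleCode.eventually_mem_eval_subst hc _ hv).exists
  obtain ⟨s, hs⟩ := (Code.eventually_isSome_evaln (Part.dom_iff_mem.2 ⟨v, hm⟩)).exists
  exact ⟨m + 1, s, m, m.lt_succ_self, hs⟩

theorem primrecPred_converges :
    PrimrecPred fun p : ℕ × List ℕ × ℕ × ℕ => Converges p.1 {k | k ∈ p.2.1} p.2.2.1 p.2.2.2 := by
  have h : PrimrecRel fun (m : ℕ) (p : ℕ × List ℕ × ℕ × ℕ) =>
      (Code.evaln p.2.2.2 (OracleCode.subst (lookupCode (initialSegment {k | k ∈ p.2.1} m))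
        (ofNat OracleCode p.1)) p.1).isSome = true := by
    have h1 : Primrec fun q : ℕ × ℕ × List ℕ × ℕ × ℕ =>
        lookupCode (initialSegment {k | k ∈ q.2.2.1} q.1) :=
      Code.primrec₂_curry.comp (.const _) (Primrec.encode.comp
        (primrec₂_initialSegment.comp (.comp .fst (.comp .snd .snd)) .fst))
    have h2 : Primrec fun q : ℕ × ℕ × List ℕ × ℕ × ℕ =>
        OracleCode.subst (lookupCode (initialSegment {k | k ∈ q.2.2.1} q.1))
          (ofNat OracleCode q.2.1) :=
      OracleCode.primrec₂_subst.comp h1 (.comp .fst .snd)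
    exact Primrec.eq.comp (Primrec.option_isSome.comp (Code.primrec_evaln.comp
      (.pair (.pair (.comp .snd (.comp .snd (.comp .snd .snd))) h2) (.comp .fst .snd))))
      (.const true)
  have hn : Primrec fun p : ℕ × List ℕ × ℕ × ℕ => p.2.2.1 := .comp .fst (.comp .snd .snd)
  refine (h.exists_mem_list.comp (Primrec.list_range.comp hn) .id).of_eq fun p => ?_
  simp only [List.mem_range, id, Converges]

/-! ### The finite-injury construction -/

namespace LowSubset

/-- The index of the requirement served at stage `s`. -/
def index (s : ℕ) : ℕ := s.unpair.1

/-- The number which may be enumerated at stage `s`. Every pair `(index s, candidate s)` recurs at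
arbitrarily large stages. -/
def candidate (s : ℕ) : ℕ := s.unpair.2.unpair.1

/-- At stage `s`, with `L` listing the numbers enumerated so far, the candidate is enumerated:
it has been found in `W e ∩ W b`, where `e` is the index served, no element of `W e` was enumerated
before, and no convergent computation of the first `e + 1` oracle programs is injured. -/
def Acts (b s : ℕ) (L : List ℕ) : Prop :=
  HaltsWithin s (index s) (candidate s) ∧ HaltsWithin s b (candidate s) ∧
    (∀ y ∈ L, ¬ HaltsWithin s (index s) y) ∧
    ∀ i < index s + 1, Converges i {k | k ∈ L} s s → Converges i {k | k ∈ L} (candidate s) s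

open Classical in
/-- The numbers enumerated before stage `s`. -/
noncomputable def stage (b : ℕ) : ℕ → List ℕ
  | 0 => []
  | s + 1 => if Acts b s (stage b s) then candidate s :: stage b s else stage b s

/-- The set of the numbers enumerated before stage `s`. -/
def stageSet (b s : ℕ) : Set ℕ := {k | k ∈ stage b s}

/-- The set enumerated by the construction. -/
def result (b : ℕ) : Set ℕ := {k | ∃ s, k ∈ stageSet b s}

theorem primrec_index : Primrec index := Primrec.fst.comp .unpair

theorem primrec_candidate : Primrec candidate :=
  Primrec.fst.comp (Primrec.unpair.comp (Primrec.snd.comp .unpair))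

theorem primrecPred_acts (b : ℕ) : PrimrecPred fun p : ℕ × List ℕ => Acts b p.1 p.2 := by
  have hi : Primrec fun p : ℕ × List ℕ => index p.1 := primrec_index.comp .fst
  have hc : Primrec fun p : ℕ × List ℕ => candidate p.1 := primrec_candidate.comp .fst
  have h1 : PrimrecPred fun p : ℕ × List ℕ => HaltsWithin p.1 (index p.1) (candidate p.1) :=
    primrecPred_haltsWithin.comp (.pair .fst (.pair hi hc))
  have h2 : PrimrecPred fun p : ℕ × List ℕ => HaltsWithin p.1 b (candidate p.1) :=
    primrecPred_haltsWithin.comp (.pair .fst (.pair (.const b) hc))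
  have h3 : PrimrecPred fun p : ℕ × List ℕ => ∀ y ∈ p.2, ¬ HaltsWithin p.1 (index p.1) y := by
    have : PrimrecRel fun (y s : ℕ) => ¬ HaltsWithin s (index s) y :=
      (primrecPred_haltsWithin.comp
        (.pair .snd (.pair (primrec_index.comp .snd) .fst))).not
    exact this.forall_mem_list.comp .snd .fst
  have h4 : PrimrecPred fun p : ℕ × List ℕ => ∀ i < index p.1 + 1,
      Converges i {k | k ∈ p.2} p.1 p.1 → Converges i {k | k ∈ p.2} (candidate p.1) p.1 := by
    have : PrimrecRel fun (i : ℕ) (p : ℕ × List ℕ) => ¬ Converges i {k | k ∈ p.2} p.1 p.1 ∨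
        Converges i {k | k ∈ p.2} (candidate p.1) p.1 := by
      have hL : Primrec fun q : ℕ × ℕ × List ℕ => q.2.2 := .comp .snd .snd
      have hs : Primrec fun q : ℕ × ℕ × List ℕ => q.2.1 := .comp .fst .snd
      exact (primrecPred_converges.comp (.pair .fst (.pair hL (.pair hs hs)))).not.or
        (primrecPred_converges.comp (.pair .fst (.pair hL (.pair (hc.comp .snd) hs))))
    refine (this.forall_mem_list.comp (Primrec.list_range.comp (Primrec.succ.comp hi))
      .id).of_eq ?_
    intro p
    simp only [List.mem_range, Nat.succ_eq_add_one, id, ← imp_iff_not_or]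
  exact h1.and (h2.and (h3.and h4))

theorem primrec_stage (b : ℕ) : Primrec (stage b) := by
  classical
  have h : Primrec fun s : ℕ => Nat.rec (motive := fun _ => List ℕ) []
      (fun s L => if Acts b s L then candidate s :: L else L) s := by
    refine Primrec.nat_rec₁ [] (Primrec.ite (primrecPred_acts b) ?_ .snd)
    exact Primrec.list_cons.comp (primrec_candidate.comp .fst) .snd
  refine h.of_eq fun s => ?_
  induction s with
  | zero => rfl
  | succ s ih => simp only [ih, stage]

variable {b : ℕ}

theorem mem_stageSet_succ {s k : ℕ} : k ∈ stageSet b (s + 1) ↔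
    k ∈ stageSet b s ∨ Acts b s (stage b s) ∧ k = candidate s := by
  by_cases h : Acts b s (stage b s) <;> simp [stageSet, stage, h, or_comm]

theorem stageSet_mono {s t : ℕ} (hst : s ≤ t) : stageSet b s ⊆ stageSet b t :=
  monotone_nat_of_le_succ (fun _ _ hk => mem_stageSet_succ.2 (.inl hk)) hst

theorem stageSet_subset_result (s : ℕ) : stageSet b s ⊆ result b := fun _ hk => ⟨s, hk⟩

theorem candidate_mem_result {s : ℕ} (h : Acts b s (stage b s)) : candidate s ∈ result b :=
  ⟨s + 1, mem_stageSet_succ.2 (.inr ⟨h, rfl⟩)⟩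

theorem mem_W_of_haltsWithin {s e x : ℕ} (h : HaltsWithin s e x) : x ∈ W e :=
  Part.dom_iff_mem.2 (Code.exists_mem_eval_of_isSome_evaln h)

theorem eventually_haltsWithin {e x : ℕ} (h : x ∈ W e) : ∀ᶠ s in atTop, HaltsWithin s e x :=
  Code.eventually_isSome_evaln h

theorem result_subset : result b ⊆ W b := by
  rintro k ⟨s, hk⟩
  induction s with
  | zero => simp [stageSet, stage] at hk
  | succ s ih =>
    obtain hk | ⟨h, rfl⟩ := mem_stageSet_succ.1 hk
    · exact ih hk
    · exact mem_W_of_haltsWithin h.2.1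

theorem rePred_mem_result : REPred fun n => n ∈ result b := by
  classical
  have h : PrimrecPred fun p : ℕ × ℕ => ∃ a ∈ stage b p.2, a = p.1 :=
    (PrimrecRel.exists_mem_list Primrec.eq).comp ((primrec_stage b).comp .snd) .fst
  have h' : Computable₂ fun n s : ℕ => decide (∃ a ∈ stage b s, a = n) := h.decide.to_comp
  refine (Partrec.rfind h'.partrec₂).dom_re.of_eq fun n => ?_
  simp only [result, stageSet, Nat.rfind_dom']
  simp

/-- Each requirement acts at most once. -/
theorem eventually_not_acts (e : ℕ) :
    ∀ᶠ s in atTop, index s = e → ¬ Acts b s (stage b s) := by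
  by_cases h : ∃ s, index s = e ∧ Acts b s (stage b s)
  · obtain ⟨s, rfl, hs⟩ := h
    filter_upwards [eventually_gt_atTop s] with t hst ht hact
    refine hact.2.2.1 (candidate s) (stageSet_mono hst (mem_stageSet_succ.2 (.inr ⟨hs, rfl⟩))) ?_
    rw [ht]
    exact Code.isSome_evaln_mono hst.le hs.1
  · push Not at h
    exact .of_forall h

/-- A computation of the `i`-th oracle program is injured finitely often. -/
theorem eventually_converges_candidate (i : ℕ) :
    ∀ᶠ s in atTop, Acts b s (stage b s) → Converges i (stageSet b s) s s →
      Converges i (stageSet b s) (candidate s) s := by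
  filter_upwards [(eventually_all_finite (Set.finite_Iio i)).2
    fun e _ => eventually_not_acts (b := b) e] with s hs hact
  refine hact.2.2.2 i (Nat.lt_succ_of_le (not_lt.1 fun hlt => ?_))
  exact hs (index s) hlt rfl hact

/-- Either the computation of the `i`-th oracle program settles with a bounded use, or it
diverges at all late stages. -/
theorem converges_dichotomy (b i : ℕ) :
    (i ∈ jump (result b) ∧ ∃ n, ∀ᶠ s in atTop, Converges i (stageSet b s) n s) ∨
      (i ∉ jump (result b) ∧ ∀ᶠ s in atTop, ¬ Converges i (stageSet b s) s s) := by
  classical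
  obtain ⟨s₀, hs₀⟩ := eventually_atTop.1 (eventually_converges_candidate (b := b) i)
  by_cases h : ∃ n, ∃ s ≥ s₀, n ≤ s ∧ Converges i (stageSet b s) n s
  · -- The least use `n` over all stages after `s₀` belongs to a computation that is never injured.
    left
    obtain ⟨s₁, hs₁, hn, hconv⟩ := Nat.find_spec h
    set n := Nat.find h
    have hind : ∀ s ≥ s₁, Converges i (stageSet b s) n s ∧
        ∀ k < n, k ∈ stageSet b s → k ∈ stageSet b s₁ := by
      intro s hs
      induction s, hs using Nat.le_induction with
      | base => exact ⟨hconv, fun _ _ hk => hk⟩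
      | succ s hs ih =>
        have hstep : ∀ k < n, k ∈ stageSet b s ↔ k ∈ stageSet b (s + 1) := by
          refine fun k hk => ⟨fun hks => stageSet_mono s.le_succ hks, fun hks => ?_⟩
          obtain hks | ⟨hact, rfl⟩ := mem_stageSet_succ.1 hks
          · exact hks
          · exact absurd ⟨s, hs₁.trans hs, hk.le.trans (hn.trans hs),
              hs₀ s (hs₁.trans hs) hact (ih.1.mono (hn.trans hs) le_rfl)⟩ (Nat.find_min h hk)
        exact ⟨(ih.1.congr hstep).mono le_rfl s.le_succ,
          fun k hk hks => ih.2 k hk ((hstep k hk).2 hks)⟩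
    refine ⟨(hconv.congr fun k hk => ⟨fun h => stageSet_subset_result _ h, ?_⟩).mem_jump,
      n, eventually_atTop.2 ⟨s₁, fun s hs => (hind s hs).1⟩⟩
    rintro ⟨s, hks⟩
    exact (hind (max s s₁) (le_max_right _ _)).2 k hk (stageSet_mono (le_max_left _ _) hks)
  · right
    push Not at h
    refine ⟨fun hi => ?_, eventually_atTop.2 ⟨s₀, fun s hs => h s s hs le_rfl⟩⟩
    obtain ⟨n, s, hconv⟩ := exists_converges_of_mem_jump hi
    have hagree : ∀ᶠ t in atTop, ∀ k ∈ Set.Iio n, k ∈ result b → k ∈ stageSet b t := by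
      refine (eventually_all_finite (Set.finite_Iio n)).2 fun k _ => ?_
      by_cases hk : k ∈ result b
      · obtain ⟨t, ht⟩ := hk
        filter_upwards [eventually_ge_atTop t] with u hu _ using stageSet_mono hu ht
      · exact .of_forall fun _ h => absurd h hk
    obtain ⟨t, ht, ht₀, hnt, hst⟩ := (hagree.and ((eventually_ge_atTop s₀).and
      ((eventually_ge_atTop n).and (eventually_ge_atTop s)))).exists
    exact h n t ht₀ hnt ((hconv.congr fun k hk =>
      ⟨ht k hk, fun h => stageSet_subset_result _ h⟩).mono le_rfl hst)

/-- A sufficiently large element of `W e ∩ W b` lies above the uses of all settled computations that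
`e` has to respect, so that it is enumerated unless `W e` is met otherwise. -/
theorem result_inter_nonempty {e : ℕ} (h : (W e ∩ W b).Infinite) : (result b ∩ W e).Nonempty := by
  have hperm : ∀ i, ∀ᶠ x in atTop, ∀ᶠ s in atTop,
      Converges i (stageSet b s) s s → Converges i (stageSet b s) x s := by
    intro i
    obtain ⟨-, n, hn⟩ | ⟨-, hn⟩ := converges_dichotomy b i
    · filter_upwards [eventually_ge_atTop n] with x hx
      filter_upwards [hn] with s hs _ using hs.mono hx le_rfl
    · refine .of_forall fun x => ?_
      filter_upwards [hn] with s hs h using absurd h hs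
  obtain ⟨x, ⟨hxe, hxb⟩, hx⟩ := ((Nat.frequently_atTop_iff_infinite.2 h).and_eventually
    ((eventually_all_finite (Set.finite_Iio (e + 1))).2 fun i _ => hperm i)).exists
  obtain ⟨t, ht⟩ := eventually_atTop.1 ((eventually_haltsWithin hxe).and
    ((eventually_haltsWithin hxb).and ((eventually_all_finite (Set.finite_Iio (e + 1))).2 hx)))
  obtain ⟨he, hb, hi⟩ := ht (Nat.pair e (Nat.pair x t))
    ((Nat.right_le_pair x t).trans (Nat.right_le_pair e _))
  set s := Nat.pair e (Nat.pair x t) with hs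
  have hindex : index s = e := by simp [index, hs]
  have hcand : candidate s = x := by simp [candidate, hs]
  by_cases hsat : ∃ y ∈ stage b s, HaltsWithin s e y
  · obtain ⟨y, hy, hye⟩ := hsat
    exact ⟨y, ⟨s, hy⟩, mem_W_of_haltsWithin hye⟩
  · -- All conditions for enumerating `x` hold at stage `s`.
    push Not at hsat
    have hact : Acts b s (stage b s) := by
      rw [Acts, hindex, hcand]
      exact ⟨he, hb, hsat, hi⟩
    exact ⟨x, hcand ▸ candidate_mem_result hact, hxe⟩

end LowSubset

/-! ### Reductions to and from the halting set -/

theorem charFun_eq_zero_iff {A : Set ℕ} {n : ℕ} : charFun A n = 0 ↔ n ∉ A := by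
  by_cases h : n ∈ A <;> simp [charFun, h]

theorem turingReducible_charFun_of_computable {X Y : Set ℕ} {t : ℕ → ℕ} (ht : Computable t)
    (h : ∀ n, n ∈ X ↔ t n ∈ Y) :
    TuringReducible (charFun X : ℕ →. ℕ) (charFun Y : ℕ →. ℕ) := by
  have hXY : charFun X = charFun Y ∘ t := by
    ext n
    by_cases hn : t n ∈ Y <;> simp [charFun, h, hn]
  rw [hXY]
  refine RecursiveIn.iff_nat.2 (.of_eq_tot (.comp (.oracle _ rfl)
    (Nat.Partrec.recursiveIn (Partrec.nat_iff.1 ht.partrec))) fun n => ?_)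
  exact Part.mem_bind_iff.2 ⟨t n, Part.mem_some _, Part.mem_some _⟩

theorem REPred.exists_W_eq {p : ℕ → Prop} (hp : REPred p) : ∃ e, W e = {n | p n} := by
  obtain ⟨c, hc⟩ := Code.exists_code.1 (Partrec.nat_iff.1
    (Partrec.map hp ((Computable.const 0).to₂ : Computable₂ fun (_ : ℕ) (_ : Unit) => 0)))
  refine ⟨encode c, ?_⟩
  ext n
  simp only [W, ofNat_encode, hc, Set.mem_ofPred_eq]
  simp [Part.assert]

theorem Nat.Partrec.Code.eval_comp_const (c : Code) (n x : ℕ) :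
    (Code.comp c (Code.const n)).eval x = c.eval n := by
  change ((Code.const n).eval x).bind c.eval = _
  rw [Code.eval_const]
  exact Part.bind_some n c.eval

/-- The halting set is complete among the computably enumerable sets. -/
theorem REPred.exists_computable_mem_haltingSet {p : ℕ → Prop} (hp : REPred p) :
    ∃ t : ℕ → ℕ, Computable t ∧ ∀ n, p n ↔ t n ∈ haltingSet := by
  obtain ⟨e, he⟩ := hp.exists_W_eq
  refine ⟨fun n => encode (Code.comp (ofNat Code e) (Code.const n)), (Primrec.encode.comp
    (Code.primrec₂_comp.comp (.const _) Code.primrec_const)).to_comp, fun n => ?_⟩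
  change n ∈ {n | p n} ↔ _
  rw [← he]
  simp only [haltingSet, W, Set.mem_ofPred_eq, ofNat_encode, Code.eval_comp_const]

/-- The jump of every set computes the halting set. -/
theorem turingReducible_haltingSet_jump (A : Set ℕ) :
    TuringReducible (charFun haltingSet : ℕ →. ℕ) (charFun (jump A) : ℕ →. ℕ) := by
  have hK : Partrec fun n => (ofNat Code n).eval n :=
    Code.eval_part.comp (Computable.ofNat Code) .id
  obtain ⟨c, hc⟩ := Code.exists_code.1 (Partrec.nat_iff.1 hK)
  have ht : Primrec fun n : ℕ =>
      2 * (2 * Nat.pair (encode (OracleCode.ofCode c)) (OracleCode.constNum n) + 1) + 5 :=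
    Primrec.nat_add.comp (Primrec.nat_double.comp (Primrec.nat_double_succ.comp
      (Primrec₂.natPair.comp (.const _) OracleCode.primrec_constNum))) (.const 5)
  refine turingReducible_charFun_of_computable ht.to_comp fun n => ?_
  have hnum : 2 * (2 * Nat.pair (encode (OracleCode.ofCode c)) (OracleCode.constNum n) + 1) + 5 =
      encode (OracleCode.ofCode (Code.comp c (Code.const n))) := rfl
  rw [hnum]
  simp only [haltingSet, W, jump, Set.mem_ofPred_eq, ofNat_encode, OracleCode.eval_ofCode,
    Code.eval_comp_const, hc]

/-- The limit lemma: the pointwise limit of a computable sequence is computable from the halting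
set, which can tell whether the sequence has already become constant. -/
theorem turingReducible_haltingSet_of_eventually_eq {f : ℕ → ℕ} {G : ℕ → ℕ → ℕ}
    (hG : Computable₂ G) (hlim : ∀ i, ∀ᶠ s in atTop, G i s = f i) :
    TuringReducible (f : ℕ →. ℕ) (charFun haltingSet : ℕ →. ℕ) := by
  have hchange : REPred fun m : ℕ =>
      ∃ k, G m.unpair.1 (m.unpair.2 + k) ≠ G m.unpair.1 m.unpair.2 := by
    have h : Computable₂ fun m k : ℕ =>
        !decide (G m.unpair.1 (m.unpair.2 + k) = G m.unpair.1 m.unpair.2) := by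
      have hi : Computable fun q : ℕ × ℕ => q.1.unpair.1 :=
        (Primrec.fst.comp (.comp .unpair .fst)).to_comp
      have hs : Computable fun q : ℕ × ℕ => q.1.unpair.2 :=
        (Primrec.snd.comp (.comp .unpair .fst)).to_comp
      exact Primrec.not.to_comp.comp (Primrec.eq.decide.to_comp.comp
        (hG.comp hi (Primrec.nat_add.to_comp.comp hs .snd)) (hG.comp hi hs))
    refine (Partrec.rfind h.partrec₂).dom_re.of_eq fun m => ?_
    simp only [Nat.rfind_dom']
    simp
  obtain ⟨t, ht, htK⟩ := hchange.exists_computable_mem_haltingSet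
  have hsearch : Nat.RecursiveIn {(charFun haltingSet : ℕ →. ℕ)} fun i => Nat.rfind fun s =>
      (fun m => m = 0) <$> (charFun (t ⁻¹' haltingSet) (Nat.pair i s) : Part ℕ) :=
    .rfind (RecursiveIn.iff_nat.1
      (turingReducible_charFun_of_computable (X := t ⁻¹' haltingSet) ht fun _ => .rfl))
  have hG' : Nat.Partrec fun m : ℕ => (G m.unpair.1 m.unpair.2 : Part ℕ) :=
    Partrec.nat_iff.1 (hG.comp (Primrec.fst.comp .unpair).to_comp
      (Primrec.snd.comp .unpair).to_comp).partrec
  refine RecursiveIn.iff_nat.2 (.of_eq_tot (.comp hG'.recursiveIn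
    (.pair (Nat.Partrec.recursiveIn Nat.Partrec.some) hsearch)) fun i => ?_)
  -- The search stops at the first stage from which on the sequence at `i` is constant.
  have hanswer : ∀ s, decide (charFun (t ⁻¹' haltingSet) (Nat.pair i s) = 0) = true ↔
      ∀ k, G i (s + k) = G i s := by
    intro s
    have := htK (Nat.pair i s)
    simp only [Nat.unpair_pair] at this
    rw [decide_eq_true_iff, charFun_eq_zero_iff, Set.mem_preimage, ← this]
    simp
  obtain ⟨s₀, hs₀⟩ := eventually_atTop.1 (hlim i)
  obtain ⟨s, hs, -⟩ := Nat.rfind_min'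
    (p := fun s => decide (charFun (t ⁻¹' haltingSet) (Nat.pair i s) = 0))
    ((hanswer s₀).2 fun k => by rw [hs₀ _ (Nat.le_add_right _ _), hs₀ _ le_rfl])
  have hconst : ∀ k, G i (s + k) = G i s :=
    (hanswer s).1 (Part.mem_some_iff.1 (Nat.rfind_spec hs)).symm
  have hval : G i s = f i := by rw [← hconst s₀, hs₀ _ (Nat.le_add_left _ _)]
  refine Part.mem_bind_iff.2 ⟨Nat.pair i s, Part.mem_bind_iff.2
    ⟨Nat.pair i, Part.mem_map _ (Part.mem_some _), Part.mem_map _ hs⟩, ?_⟩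
  rw [Nat.unpair_pair, hval]
  exact Part.mem_some _

/-! ### Low sets and fixed points -/

/-- Below every computably enumerable set there is a low one that meets each computably enumerable
set with which the given set has an infinite intersection. -/
theorem exists_isLow_subset (b : ℕ) : ∃ A : Set ℕ, REPred (fun n => n ∈ A) ∧ IsLow A ∧ A ⊆ W b ∧
    ∀ e, (W e ∩ W b).Infinite → (A ∩ W e).Nonempty := by
  classical
  refine ⟨LowSubset.result b, LowSubset.rePred_mem_result, ⟨?_, turingReducible_haltingSet_jump _⟩,
    LowSubset.result_subset, fun e => LowSubset.result_inter_nonempty⟩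
  let G : ℕ → ℕ → ℕ := fun i s => if Converges i (LowSubset.stageSet b s) s s then 1 else 0
  have hG : Primrec₂ G := by
    refine Primrec.ite ?_ (.const 1) (.const 0)
    exact primrecPred_converges.comp
      (.pair .fst (.pair ((LowSubset.primrec_stage b).comp .snd) (.pair .snd .snd)))
  refine turingReducible_haltingSet_of_eventually_eq hG.to_comp fun i => ?_
  obtain ⟨hi, n, hn⟩ | ⟨hi, hn⟩ := LowSubset.converges_dichotomy b i
  · filter_upwards [hn, eventually_ge_atTop n] with s hs hns
    simp [G, charFun, hi, hs.mono hns le_rfl]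
  · filter_upwards [hn] with s hs
    simp [G, charFun, hi, hs]

/-- There are a low c.e. set `A` and an `A`-computable binary function `h`, which moreover reads
only two bits of `A` per argument, such that no computable `f` gives fixed points of `h` uniformly
in the parameter. -/
theorem mainTheorem1 :
    ∃ (A : Set ℕ) (h : ℕ → ℕ → ℕ),
      REPred (fun n => n ∈ A) ∧ IsLow A ∧
      ComputableIn₂ {(charFun A : ℕ →. ℕ)} h ∧ ComputableFromTwoBits A h ∧
      ∀ f : ℕ → ℕ, Computable f → ∃ n, W (f n) ≠ W (h n (f n)) := by
  obtain ⟨e₀, he₀⟩ : ∃ e, W e = ∅ :=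
    (ComputablePred.to_re (p := fun _ : ℕ => False) ⟨inferInstance, .const _⟩).exists_W_eq.imp
      fun e he => by simpa using he
  obtain ⟨e₁, he₁⟩ : ∃ e, W e = Set.univ :=
    (ComputablePred.to_re (p := fun _ : ℕ => True) ⟨inferInstance, .const _⟩).exists_W_eq.imp
      fun e he => by simpa using he
  obtain ⟨b, hb⟩ : ∃ b, W b = {m | 0 ∈ W m.unpair.2} := by
    refine REPred.exists_W_eq ?_
    exact Partrec.dom_re (Code.eval_part.comp
      ((Computable.ofNat Code).comp (Primrec.snd.comp .unpair).to_comp) (.const 0))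
  obtain ⟨A, hre, hlow, hsub, hmeet⟩ := exists_isLow_subset b
  let g : ℕ → ℕ := fun v => if v = 1 then e₀ else e₁
  have hg : Primrec g := .ite (Primrec.eq.comp .id (.const 1)) (.const _) (.const _)
  refine ⟨A, fun n x => g (charFun A (Nat.pair n x)), hre, hlow, ?_,
    ⟨Nat.pair, Nat.pair, fun _ v => g v.1, Primrec₂.natPair.to_comp, Primrec₂.natPair.to_comp,
      (hg.comp (.comp .fst .snd)).to_comp, fun _ _ => rfl⟩, fun f hf => ?_⟩
  · -- `h` is `g` after the oracle, as the pair `(n, x)` is coded by the number `Nat.pair n x`.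
    have : Nat.RecursiveIn {(charFun A : ℕ →. ℕ)} fun m =>
        (charFun A m : Part ℕ) >>= (g : ℕ →. ℕ) :=
      .comp (Nat.Partrec.recursiveIn (Partrec.nat_iff.1 hg.to_comp.partrec)) (.oracle _ rfl)
    refine this.of_eq fun m => ?_
    have hdec : (decode m : Option (ℕ × ℕ)) = some m.unpair := by simp
    rw [hdec]
    refine (Part.bind_some (charFun A m) (g : ℕ →. ℕ)).trans
      ((Part.bind_some m.unpair _).trans ?_).symm
    simp
  · by_contra! hfix
    obtain ⟨e, he⟩ : ∃ e, W e = {m | m.unpair.2 = f m.unpair.1} := by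
      refine REPred.exists_W_eq (ComputablePred.to_re ⟨inferInstance, ?_⟩)
      exact Primrec.eq.decide.to_comp.comp (Primrec.snd.comp .unpair).to_comp
        (hf.comp (Primrec.fst.comp .unpair).to_comp)
    -- By the choice of `h`, the pair `(n, f n)` is in `A` if and only if `0 ∉ W (f n)`.
    have hmem : ∀ n, Nat.pair n (f n) ∈ A ↔ 0 ∉ W (f n) := by
      intro n
      by_cases hn : Nat.pair n (f n) ∈ A
      · simp [hfix n, g, charFun, hn, he₀]
      · simp [hfix n, g, charFun, hn, he₁]
    have hnot : ∀ n, Nat.pair n (f n) ∉ A := fun n hn =>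
      (hmem n).1 hn (by simpa [hb] using hsub hn)
    have hinf : (W e ∩ W b).Infinite := by
      refine Set.infinite_of_injective_forall_mem (f := fun n => Nat.pair n (f n))
        (fun n m hnm => (Nat.pair_eq_pair.1 hnm).1) fun n => ?_
      simpa [he, hb] using not_not.1 (mt (hmem n).2 (hnot n))
    obtain ⟨m, hmA, hme⟩ := hmeet e hinf
    rw [he] at hme
    refine hnot m.unpair.1 ?_
    rwa [← show m.unpair.2 = f m.unpair.1 from hme, Nat.pair_unpair]
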